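/- Let $(X,\mu)$ be a measure space, $H$ a complex Hilbert space, and let $A$ be a (possibly unbounded) positive self-adjoint operator on $\mathcal H=L^2(X,H)$, with closed quadratic form $\mathcal E(f)=\|A^{1/2}f\|_2^2\in[0,\infty]$ ($=\infty$ if $f\notin D(A^{1/2})$). For a bounded positive operator $P$ on $\mathcal H$ let $\tau(P)\in[0,\infty]$ be its trace, and put $\nu_P(\Omega)=\tau(\chi_\Omega P\chi_\Omega)$ for measurable $\Omega\subset X$ and $D(P)=\sup_\Omega \nu_P(\Omega)/\mu(\Omega)$ (supremum over measurable sets with $0<\mu(\Omega)<\infty$). For a bounded positive operator $\rho$ put $\mathcal E(\rho)=\tau(\rho^{1/2}A\rho^{1/2})=\sum_i\mathcal E(\rho^{1/2}e_i)\in[0,\infty]$, where $(e_i)$ is a Hilbert basis of $\mathcal H$. Fix one of the following two settings: (a) $\Pi_\lambda=\chi_A([0,\lambda])$, and $W=\mathcal H$; (b) $\Pi_\lambda=\chi_A(]0,\lambda])$, and $W=(\ker A)^\perp$. For $\lambda\ge 0$ let $F_\Omega(\lambda)=\nu_{\Pi_\lambda}(\Omega)$ and $F(\lambda)=D(\Pi_\lambda)$.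 Let $\Omega\subset X$ be measurable with $\mu(\Omega)<\infty$. 1. Let $\rho\neq0$ be a bounded positive operator on $\mathcal H$ that is supported in $\Omega$ (every $\rho f$ vanishes a.e. outside $\Omega$), with $\rho=0$ on $\ker A$ in setting (b), and with $\mathcal E(\rho)<\infty$. Suppose that $\tau(\rho)<\infty$, or that $F_\Omega(\lambda)<\infty$ for some $\lambda>0$. Then $\tau(\rho)<\infty$ and $$\frac{\tau(\rho)}{4\|\rho\|_{2,2}}\le F_\Omega\bigl(4\langle A\rangle_\rho\bigr)\le\mu(\Omega)\,F\bigl(4\langle A\rangle_\rho\bigr),\qquad \langle A\rangle_\rho=\frac{\mathcal E(\rho)}{\tau(\rho)},$$ where $\|\rho\|_{2,2}$ is the operator norm. ($\langle A\rangle_\rho$ is also written $\tau(A\rho)/\tau(\rho)$.) 2. For every $\lambda\ge0$, $$F_\Omega^{\dim}(\lambda)\le 4\,\mu(\Omega)\,F(4\lambda),$$ where $F_\Omega^{\dim}(\lambda)$ is the supremum of $\dim V$ over all linear subspaces $V\subset W$ whose elements vanish a.e. outside $\Omega$ and satisfy $\mathcal E(f)\le\lambda\|f\|_2^2$ for all $f\in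 V$. Here all values lie in $[0,\infty]$, with the convention $0\cdot\infty=0$. -/

import Mathlib

open MeasureTheory Filter Topology
open scoped ENNReal InnerProductSpace

noncomputable section

namespace SpectralFK

section Hilbert

variable {E : Type*} [NormedAddCommGroup E] [InnerProductSpace ℂ E]

/-- Parseval's identity with values in `[0, ∞]`. -/
theorem tsum_enorm_inner_sq {ι : Type*} (b : HilbertBasis ι ℂ E) (x : E) :
    ∑' i, ‖⟪b i, x⟫_ℂ‖ₑ ^ 2 = ‖x‖ₑ ^ 2 := by
  have h := (b.hasSum_inner_mul_inner x x).mapL Complex.reCLM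
  have h' : HasSum (fun i => ‖⟪b i, x⟫_ℂ‖ ^ 2) (‖x‖ ^ 2) := by
    convert h using 1
    · funext i
      have : ⟪x, b i⟫_ℂ = (starRingEnd ℂ) ⟪b i, x⟫_ℂ := (inner_conj_symm _ _).symm
      rw [this, Complex.conj_mul']
      simp [← Complex.ofReal_pow]
    · rw [inner_self_eq_norm_sq_to_K]
      simp [← Complex.ofReal_pow]
  have e (y : ℝ) (hy : 0 ≤ y) : ENNReal.ofReal (y ^ 2) = ENNReal.ofReal y ^ 2 :=
    ENNReal.ofReal_pow hy 2
  have := ENNReal.ofReal_tsum_of_nonneg (fun i => sq_nonneg ‖⟪b i, x⟫_ℂ‖) h'.summable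
  rw [h'.tsum_eq, e _ (norm_nonneg _), ofReal_norm] at this
  rw [this]
  exact tsum_congr fun i => by rw [e _ (norm_nonneg _), ofReal_norm]

variable [CompleteSpace E]

/-! ### Traces along a Hilbert basis -/

/-- The sum `∑ Q(e)` over an (arbitrarily chosen) Hilbert basis of `E`. -/
def basisSum (Q : E → ℝ≥0∞) : ℝ≥0∞ :=
  ∑' e : (exists_hilbertBasis ℂ E).choose, Q (e : E)

/-- The trace `τ(P) = ∑ ⟨P e, e⟩ ∈ [0, ∞]` of a bounded positive operator `P`. -/
def trace (P : E →L[ℂ] E) : ℝ≥0∞ :=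
  basisSum fun e => ENNReal.ofReal (⟪P e, e⟫_ℂ).re

/-- `∑ ‖S b_i‖² = ∑ ‖S* c_j‖²` for any two Hilbert bases. -/
theorem tsum_enorm_sq_eq_adjoint {ι κ : Type*} (b : HilbertBasis ι ℂ E) (c : HilbertBasis κ ℂ E)
    (S : E →L[ℂ] E) :
    ∑' i, ‖S (b i)‖ₑ ^ 2 = ∑' j, ‖ContinuousLinearMap.adjoint S (c j)‖ₑ ^ 2 := by
  calc ∑' i, ‖S (b i)‖ₑ ^ 2 = ∑' i, ∑' j, ‖⟪c j, S (b i)⟫_ℂ‖ₑ ^ 2 :=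
        tsum_congr fun i => (tsum_enorm_inner_sq c _).symm
    _ = ∑' j, ∑' i, ‖⟪c j, S (b i)⟫_ℂ‖ₑ ^ 2 := ENNReal.tsum_comm
    _ = ∑' j, ∑' i, ‖⟪b i, ContinuousLinearMap.adjoint S (c j)⟫_ℂ‖ₑ ^ 2 := by
        refine tsum_congr fun j => tsum_congr fun i => ?_
        rw [← ContinuousLinearMap.adjoint_inner_left, ← ofReal_norm, norm_inner_symm, ofReal_norm]
    _ = _ := tsum_congr fun j => tsum_enorm_inner_sq b _

/-- The trace of a positive operator may be computed in any Hilbert basis. -/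
theorem trace_eq_tsum {ι : Type*} (b : HilbertBasis ι ℂ E) {P : E →L[ℂ] E} (hP : P.IsPositive) :
    trace P = ∑' i, ENNReal.ofReal (⟪P (b i), b i⟫_ℂ).re := by
  have hP' : 0 ≤ P := (ContinuousLinearMap.nonneg_iff_isPositive P).2 hP
  have hS : IsSelfAdjoint (CFC.sqrt P) := (CFC.sqrt_nonneg P).isSelfAdjoint
  have key (x : E) : ENNReal.ofReal (⟪P x, x⟫_ℂ).re = ‖CFC.sqrt P x‖ₑ ^ 2 := by
    have h1 : P x = CFC.sqrt P (CFC.sqrt P x) := by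
      conv_lhs => rw [← CFC.sqrt_mul_sqrt_self P hP']
      rfl
    rw [h1, ← ContinuousLinearMap.adjoint_inner_right, ContinuousLinearMap.isSelfAdjoint_iff'.1 hS,
      inner_self_eq_norm_sq_to_K, ← ofReal_norm, ← ENNReal.ofReal_pow (norm_nonneg _)]
    simp [← Complex.ofReal_pow]
  obtain ⟨c, hc⟩ := (exists_hilbertBasis ℂ E).choose_spec
  have h1 := tsum_enorm_sq_eq_adjoint b c (CFC.sqrt P)
  rw [ContinuousLinearMap.isSelfAdjoint_iff'.1 hS] at h1
  simp only [trace, basisSum, key]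
  rw [h1, hc]

end Hilbert

/-! ### Positive self-adjoint operators -/

/-- A (possibly unbounded) positive self-adjoint operator on a Hilbert space.
Self-adjointness of a `LinearPMap` means `A† = A` with equality of domains; it implies that the
domain is dense. -/
structure PosSelfAdjoint (E : Type*) [NormedAddCommGroup E] [InnerProductSpace ℂ E]
    [CompleteSpace E] where
  op : E →ₗ.[ℂ] E
  selfAdjoint : IsSelfAdjoint op
  nonneg : ∀ f : op.domain, 0 ≤ (⟪op f, (f : E)⟫_ℂ).re

namespace PosSelfAdjoint

variable {E : Type*} [NormedAddCommGroup E] [InnerProductSpace ℂ E] [CompleteSpace E]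
  (A : PosSelfAdjoint E)

theorem symm_apply (f g : A.op.domain) : ⟪A.op f, (g : E)⟫_ℂ = ⟪(f : E), A.op g⟫_ℂ := by
  have h := A.op.adjoint_isFormalAdjoint A.selfAdjoint.dense_domain
  have e : A.op.adjoint = A.op := A.selfAdjoint
  rw [e] at h
  exact h f g

theorem norm_le_norm_add (g : A.op.domain) : ‖(g : E)‖ ≤ ‖(g : E) + A.op g‖ := by
  have h1 : ‖(g : E)‖ ^ 2 ≤ (⟪(g : E) + A.op g, (g : E)⟫_ℂ).re := by
    rw [inner_add_left, Complex.add_re, inner_self_eq_norm_sq_to_K]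
    have := A.nonneg g
    simpa [← Complex.ofReal_pow] using this
  have h2 : (⟪(g : E) + A.op g, (g : E)⟫_ℂ).re ≤ ‖(g : E) + A.op g‖ * ‖(g : E)‖ :=
    (Complex.re_le_norm _).trans (norm_inner_le_norm _ _)
  rcases (norm_nonneg (g : E)).eq_or_lt with h | h
  · rw [← h]; positivity
  · nlinarith

/-- The range of `1 + A`. -/
def addRange : Submodule ℂ E :=
  LinearMap.range (A.op.domain.subtype + A.op.toFun)

theorem addRange_eq_top : A.addRange = ⊤ := by
  have hcl : A.op.IsClosed := A.selfAdjoint.isClosed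
  have hclosed : IsClosed (A.addRange : Set E) := by
    rw [← isSeqClosed_iff_isClosed]
    intro u y hu hy
    choose g hg using hu
    have hg' (n : ℕ) : (g n : E) + A.op (g n) = u n := hg n
    have hc : CauchySeq fun n => (g n : E) := by
      have hcu := hy.cauchySeq
      rw [Metric.cauchySeq_iff] at hcu ⊢
      intro ε hε
      obtain ⟨N, hN⟩ := hcu ε hε
      refine ⟨N, fun m hm n hn => lt_of_le_of_lt ?_ (hN m hm n hn)⟩
      have h := A.norm_le_norm_add (g m - g n)
      have e : ((g m - g n : A.op.domain) : E) + A.op (g m - g n) = u m - u n := by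
        rw [LinearPMap.map_sub, ← hg' m, ← hg' n]
        push_cast
        abel
      rw [e] at h
      rw [dist_eq_norm, dist_eq_norm]
      exact h
    obtain ⟨x, hx⟩ := cauchySeq_tendsto_of_complete hc
    have hA : Tendsto (fun n => A.op (g n)) atTop (𝓝 (y - x)) := by
      have := hy.sub hx
      refine this.congr fun n => ?_
      rw [← hg' n]; abel
    have hmem : (x, y - x) ∈ (A.op.graph : Set (E × E)) :=
      hcl.mem_of_tendsto (hx.prodMk_nhds hA)
        (Eventually.of_forall fun n => A.op.mem_graph (g n))
    obtain ⟨z, hz1, hz2⟩ := (LinearPMap.mem_graph_iff A.op).1 hmem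
    refine ⟨z, ?_⟩
    change (z : E) + A.op z = y
    rw [hz1, hz2]; simp
  have horth : A.addRangeᗮ = ⊥ := by
    rw [Submodule.eq_bot_iff]
    intro y hy
    have hy' (x : A.op.domain) : ⟪-y, (x : E)⟫_ℂ = ⟪y, A.op x⟫_ℂ := by
      have h0 : ⟪y, (x : E) + A.op x⟫_ℂ = 0 := by
        have h1 : (x : E) + A.op x ∈ A.addRange := ⟨x, rfl⟩
        rw [← inner_conj_symm, (Submodule.mem_orthogonal _ _).1 hy _ h1, map_zero]
      rw [inner_add_right] at h0
      rw [inner_neg_left]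
      linear_combination -h0
    have e : A.op.adjoint = A.op := A.selfAdjoint
    have hmem : y ∈ A.op.adjoint.domain := A.op.mem_adjoint_domain_of_exists y ⟨-y, hy'⟩
    have happ := A.op.adjoint_apply_eq A.selfAdjoint.dense_domain ⟨y, hmem⟩ hy'
    have hg : (y, -y) ∈ A.op.adjoint.graph := by
      rw [← happ]
      exact A.op.adjoint.mem_graph ⟨y, hmem⟩
    rw [e] at hg
    obtain ⟨z, hz1, hz2⟩ := (LinearPMap.mem_graph_iff A.op).1 hg
    have h := A.norm_le_norm_add z
    rw [hz1, hz2] at h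
    simpa using h
  have := hclosed.submodule_topologicalClosure_eq
  rw [← this, Submodule.topologicalClosure_eq_top_iff]
  exact horth

theorem exists_resolvent :
    ∃ R : E →L[ℂ] E, ∀ f, ∃ h : R f ∈ A.op.domain, R f + A.op ⟨R f, h⟩ = f := by
  have hs (f : E) : ∃ g : A.op.domain, (g : E) + A.op g = f := by
    have : f ∈ A.addRange := A.addRange_eq_top ▸ Submodule.mem_top
    exact this
  choose r hr using hs
  have hinj (g g' : A.op.domain) (h : (g : E) + A.op g = g' + A.op g') : (g : E) = g' := by
    have h1 := A.norm_le_norm_add (g - g')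
    have h2 : ((g - g' : A.op.domain) : E) + A.op (g - g') = 0 := by
      rw [LinearPMap.map_sub]
      push_cast
      rw [← sub_eq_zero] at h
      rw [← h]; abel
    rw [h2, norm_zero] at h1
    have h3 : ((g - g' : A.op.domain) : E) = 0 := norm_le_zero_iff.1 h1
    push_cast at h3
    exact sub_eq_zero.1 h3
  refine ⟨LinearMap.mkContinuous
    { toFun := fun f => (r f : E)
      map_add' := fun x y => ?_
      map_smul' := fun c x => ?_ } 1 fun x => ?_, fun f => ⟨(r f).2, hr f⟩⟩
  · refine hinj (r (x + y)) (r x + r y) ?_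
    rw [hr, LinearPMap.map_add]
    push_cast
    nth_rewrite 1 [← hr x, ← hr y]
    abel
  · refine hinj (r (c • x)) (c • r x) ?_
    rw [hr, LinearPMap.map_smul]
    push_cast
    nth_rewrite 1 [← hr x]
    rw [smul_add]
  · have := A.norm_le_norm_add (r x)
    rw [hr] at this
    simpa using this

/-- The bounded operator `(1 + A)⁻¹`. -/
def resolvent : E →L[ℂ] E := A.exists_resolvent.choose

theorem resolvent_spec (f : E) :
    ∃ h : A.resolvent f ∈ A.op.domain, A.resolvent f + A.op ⟨A.resolvent f, h⟩ = f :=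
  A.exists_resolvent.choose_spec f

/-- The continuous functional calculus below is applied to a self-adjoint operator. -/
theorem resolvent_isSelfAdjoint : IsSelfAdjoint A.resolvent := by
  rw [ContinuousLinearMap.isSelfAdjoint_iff_isSymmetric]
  intro f g
  obtain ⟨hf, hf'⟩ := A.resolvent_spec f
  obtain ⟨hg, hg'⟩ := A.resolvent_spec g
  change ⟪A.resolvent f, g⟫_ℂ = ⟪f, A.resolvent g⟫_ℂ
  have := A.symm_apply ⟨_, hf⟩ ⟨_, hg⟩
  conv_lhs => rw [← hg']
  conv_rhs => rw [← hf']
  rw [inner_add_left, inner_add_right, this]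

/-- The kernel of `A`, as a subspace of the whole Hilbert space. -/
def kernel : Submodule ℂ E := (LinearMap.ker A.op.toFun).map A.op.domain.subtype

/-- The spectral subspace of `A` for `[0, l]`, `l ≥ 0`: since `A ≤ l` if and only if
`(1 + A)⁻¹ ≥ 1 / (1 + l)`, it is the kernel of the negative part of `(1 + A)⁻¹ - 1 / (1 + l)`. -/
def spectralSubspace (l : ℝ) : Submodule ℂ E :=
  (cfc (fun x : ℝ => max (1 / (1 + l) - x) 0) A.resolvent : E →L[ℂ] E).ker

instance (l : ℝ) : CompleteSpace (A.spectralSubspace l) :=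
  ContinuousLinearMap.completeSpace_ker _

/-- The spectral projection `χ_A([0, l])`, for `l ≥ 0`. -/
def projIcc (l : ℝ) : E →L[ℂ] E := (A.spectralSubspace l).starProjection

/-- The spectral projection `χ_A(]0, l]) = χ_A([0, l]) - χ_A({0})`, for `l ≥ 0`. -/
def projIoc (l : ℝ) : E →L[ℂ] E := A.projIcc l - A.projIcc 0

/-- The energy `𝓔(f) ∈ [0, ∞]`: the closure of the quadratic form `g ↦ ⟨A g, g⟩`, `g ∈ D(A)`, that
is, its lower semicontinuous relaxation. It is `‖A^{1/2} f‖²` on the domain of `A^{1/2}` and `∞`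
elsewhere. -/
def energy (f : E) : ℝ≥0∞ :=
  liminf (fun g : A.op.domain => ENNReal.ofReal (⟪A.op g, (g : E)⟫_ℂ).re)
    (comap (fun g : A.op.domain => (g : E)) (𝓝 f))

/-- On the domain of `A` the energy is `⟨A f, f⟩`. -/
theorem energy_of_mem_domain (f : A.op.domain) :
    A.energy f = ENNReal.ofReal (⟪A.op f, (f : E)⟫_ℂ).re := by
  apply le_antisymm
  · have hp : pure f ≤ comap (fun g : A.op.domain => (g : E)) (𝓝 (f : E)) := by
      rw [← map_le_iff_le_comap, map_pure]
      exact pure_le_nhds _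
    refine (liminf_le_liminf_of_le hp).trans ?_
    simp [liminf_eq, sSup_le_iff]
  · have ht : Tendsto (fun g : A.op.domain => ENNReal.ofReal
        ((⟪A.op f, (f : E)⟫_ℂ).re + 2 * (⟪A.op f, (g : E) - f⟫_ℂ).re))
        (comap (fun g : A.op.domain => (g : E)) (𝓝 (f : E)))
        (𝓝 (ENNReal.ofReal (⟪A.op f, (f : E)⟫_ℂ).re)) := by
      have hc : Continuous fun x : E => ENNReal.ofReal
          ((⟪A.op f, (f : E)⟫_ℂ).re + 2 * (⟪A.op f, x - f⟫_ℂ).re) :=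
        ENNReal.continuous_ofReal.comp (continuous_const.add (continuous_const.mul
          (Complex.continuous_re.comp
            (continuous_const.inner (𝕜 := ℂ) (continuous_id.sub continuous_const)))))
      have := (hc.tendsto (f : E)).comp
        (tendsto_comap (f := fun g : A.op.domain => (g : E)) (x := 𝓝 (f : E)))
      simpa [Function.comp_def] using this
    have : (comap (fun g : A.op.domain => (g : E)) (𝓝 (f : E))).NeBot :=
      comap_neBot fun t ht' => ⟨f, mem_of_mem_nhds ht'⟩
    rw [← ht.liminf_eq]
    refine liminf_le_liminf (Eventually.of_forall fun g => ENNReal.ofReal_le_ofReal ?_)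
    have h := A.nonneg (g - f)
    rw [LinearPMap.map_sub] at h
    push_cast at h
    have h1 : (⟪A.op g, (f : E)⟫_ℂ).re = (⟪A.op f, (g : E)⟫_ℂ).re := by
      rw [A.symm_apply, ← inner_conj_symm, Complex.conj_re]
    simp only [inner_sub_left, inner_sub_right, Complex.sub_re] at h ⊢
    linarith

/-- The energy `𝓔(ρ) = τ(ρ^{1/2} A ρ^{1/2}) = ∑ 𝓔(ρ^{1/2} e)` of a bounded positive operator. -/
def stateEnergy (ρ : E →L[ℂ] E) : ℝ≥0∞ :=
  basisSum fun e => A.energy (CFC.sqrt ρ e)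

/-- The expectation value `⟨A⟩_ρ = 𝓔(ρ) / τ(ρ)`, for `𝓔(ρ) < ∞` and `0 < τ(ρ) < ∞`. -/
def expectation (ρ : E →L[ℂ] E) : ℝ := (A.stateEnergy ρ / trace ρ).toReal

end PosSelfAdjoint

/-! ### Densities on `L²(X, H)` -/

section Lp

variable {X : Type*} [MeasurableSpace X] {μ : Measure X}
  {H : Type*} [NormedAddCommGroup H] [InnerProductSpace ℂ H]

/-- Multiplication by the indicator function `χ_Ω` on `L²(X, H)`, as a linear map. -/
def chiLin {Ω : Set X} (hΩ : MeasurableSet Ω) : Lp H 2 μ →ₗ[ℂ] Lp H 2 μ where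
  toFun f := MemLp.toLp (Ω.indicator f) ((Lp.memLp f).indicator hΩ)
  map_add' f g := by
    rw [← MemLp.toLp_add]
    apply MemLp.toLp_congr
    filter_upwards [Lp.coeFn_add f g] with x hx
    by_cases h : x ∈ Ω
    · rw [Set.indicator_of_mem h, Pi.add_apply, Set.indicator_of_mem h, Set.indicator_of_mem h, hx,
        Pi.add_apply]
    · simp [h]
  map_smul' c f := by
    rw [RingHom.id_apply, ← MemLp.toLp_const_smul]
    apply MemLp.toLp_congr
    filter_upwards [Lp.coeFn_smul c f] with x hx
    by_cases h : x ∈ Ω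
    · rw [Set.indicator_of_mem h, Pi.smul_apply, Set.indicator_of_mem h, hx, Pi.smul_apply]
    · simp [h]

theorem norm_chiLin_le {Ω : Set X} (hΩ : MeasurableSet Ω) (f : Lp H 2 μ) :
    ‖chiLin hΩ f‖ ≤ ‖f‖ := by
  have h : chiLin hΩ f = MemLp.toLp (Ω.indicator f) ((Lp.memLp f).indicator hΩ) := rfl
  rw [h, Lp.norm_toLp, Lp.norm_def]
  exact ENNReal.toReal_mono (Lp.eLpNorm_ne_top f) (eLpNorm_indicator_le _)

/-- Multiplication by the indicator function `χ_Ω` on `L²(X, H)`. -/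
def chi {Ω : Set X} (hΩ : MeasurableSet Ω) : Lp H 2 μ →L[ℂ] Lp H 2 μ :=
  LinearMap.mkContinuous (chiLin hΩ) 1 fun f => by
    rw [one_mul]
    exact norm_chiLin_le hΩ f

/-- The function `f` vanishes almost everywhere outside `Ω`. -/
def SupportedIn (Ω : Set X) (f : Lp H 2 μ) : Prop := ∀ᵐ x ∂μ, x ∉ Ω → f x = 0

variable [CompleteSpace H]

/-- The measure `ν_P(Ω) = τ(χ_Ω P χ_Ω)`. -/
def nu (P : Lp H 2 μ →L[ℂ] Lp H 2 μ) {Ω : Set X} (hΩ : MeasurableSet Ω) : ℝ≥0∞ :=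
  trace (chi hΩ ∘L P ∘L chi hΩ)

/-- The density `D(P) = sup_Ω ν_P(Ω) / μ(Ω)`; sets of measure `0` or `∞` contribute `0`. -/
def density (P : Lp H 2 μ →L[ℂ] Lp H 2 μ) : ℝ≥0∞ :=
  ⨆ (Ω : Set X) (hΩ : MeasurableSet Ω), nu P hΩ / μ Ω

/-- The supremum of `dim V` over the linear subspaces `V ⊆ W` of functions supported in `Ω` with
`𝓔(f) ≤ l ‖f‖²` for all `f ∈ V`. -/
def dirichletCount (A : PosSelfAdjoint (Lp H 2 μ)) (W : Submodule ℂ (Lp H 2 μ)) (Ω : Set X)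
    (l : ℝ) : ℝ≥0∞ :=
  ⨆ (V : Submodule ℂ (Lp H 2 μ)) (_ : V ≤ W) (_ : ∀ f ∈ V, SupportedIn Ω f)
    (_ : ∀ f ∈ V, A.energy f ≤ ENNReal.ofReal (l * ‖f‖ ^ 2)),
    ((Cardinal.toENat (Module.rank ℂ V) : ℕ∞) : ℝ≥0∞)

end Lp

end SpectralFK

end

/-! The argument is Chebyshev's inequality for the spectral measure, followed by a Hilbert–Schmidt
estimate. Since `A ≥ l` on the range of `1 - Π_l`, one has `l ‖f - Π_l f‖² ≤ 𝓔(f)`. For `f = ρ^{1/2}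
e_i`, summed over a basis, with `l = 4⟨A⟩_ρ`, the high-energy part carries at most a quarter of
`τ(ρ)`, so `τ(ρ) ≤ 4 ∑ ‖Π_l ρ^{1/2} e_i‖²`. As `ρ^{1/2} = ρ^{1/2} χ_Ω`, this Hilbert–Schmidt sum is
at most `‖ρ‖ τ(χ_Ω Π_l χ_Ω)`. For the dimension count the same inequality is applied to each vector
of an orthonormal family in `V`.

The unbounded operator enters only through `R = (1 + A)⁻¹`. The form bound is proved on `D(A)`, the
range of `R`, by functional calculus of `R` (`mul_norm_resolvent_sq_le`), and passes to the closed
form because its left side is continuous in `f`. At `l = 0` Chebyshev is void; there zero energy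
forces `f ∈ ker A`. The structure `IsCutoff` records what both settings share, with `K = ⊥` or `K =
ker A` and `W = Kᗮ`. -/

namespace SpectralFK

/-! ### Functional calculus and norms -/

section Hilbert

variable {E : Type*} [NormedAddCommGroup E] [InnerProductSpace ℂ E]

theorem re_inner_self (f : E) : (⟪f, f⟫_ℂ).re = ‖f‖ ^ 2 := by
  rw [inner_self_eq_norm_sq_to_K]
  simp [← Complex.ofReal_pow]

theorem ofReal_re_inner_self (f : E) : ENNReal.ofReal (⟪f, f⟫_ℂ).re = ‖f‖ₑ ^ 2 := by
  rw [re_inner_self, ENNReal.ofReal_pow (norm_nonneg _), ofReal_norm]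

variable [CompleteSpace E]

theorem inner_apply_comm {S : E →L[ℂ] E} (hS : IsSelfAdjoint S) (f g : E) :
    ⟪S f, g⟫_ℂ = ⟪f, S g⟫_ℂ := by
  rw [← ContinuousLinearMap.adjoint_inner_right, ContinuousLinearMap.isSelfAdjoint_iff'.1 hS]

/-- Operators that dominate each other in modulus on the spectrum dominate each other in norm. -/
theorem norm_cfc_apply_le (R : E →L[ℂ] E) {φ ψ : ℝ → ℝ}
    (hφ : Continuous φ) (hψ : Continuous ψ) (h : ∀ x ∈ spectrum ℝ R, |φ x| ≤ |ψ x|) (f : E) :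
    ‖cfc φ R f‖ ≤ ‖cfc ψ R f‖ := by
  have h0 : cfc (fun x => φ x * φ x) R ≤ cfc (fun x => ψ x * ψ x) R :=
    cfc_mono (fun x hx => abs_le_iff_mul_self_le.1 (h x hx))
      (by fun_prop) (by fun_prop)
  rw [cfc_mul φ φ R, cfc_mul ψ ψ R] at h0
  have h1 := (ContinuousLinearMap.le_def _ _).1 h0 |>.re_inner_nonneg_left f
  have e (χ : ℝ → ℝ) : RCLike.re ⟪(cfc χ R * cfc χ R) f, f⟫_ℂ = ‖cfc χ R f‖ ^ 2 := by
    rw [mul_apply_eq_comp, inner_apply_comm (cfc_predicate χ R)]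
    exact re_inner_self _
  rw [sub_apply, inner_sub_left, map_sub, e, e] at h1
  exact (sq_le_sq₀ (norm_nonneg _) (norm_nonneg _)).1 (by linarith)

end Hilbert

/-! ### Spectral subspaces through the resolvent -/

namespace PosSelfAdjoint

variable {E : Type*} [NormedAddCommGroup E] [InnerProductSpace ℂ E] [CompleteSpace E]
  (A : PosSelfAdjoint E)

theorem eq_of_add_apply_eq (g g' : A.op.domain) (h : (g : E) + A.op g = g' + A.op g') :
    g = g' := by
  have h1 := A.norm_le_norm_add (g - g')
  have h2 : ((g - g' : A.op.domain) : E) + A.op (g - g') = 0 := by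
    rw [LinearPMap.map_sub]
    push_cast
    rw [← sub_eq_zero] at h
    rw [← h]; abel
  rw [h2, norm_zero] at h1
  exact sub_eq_zero.1 (Subtype.ext (norm_le_zero_iff.1 h1))

theorem resolvent_add_apply (g : A.op.domain) : A.resolvent ((g : E) + A.op g) = g := by
  obtain ⟨h, h'⟩ := A.resolvent_spec ((g : E) + A.op g)
  exact congrArg Subtype.val (A.eq_of_add_apply_eq ⟨_, h⟩ g h')

theorem re_inner_sub_resolvent_nonneg (f : E) :
    0 ≤ (⟪f - A.resolvent f, A.resolvent f⟫_ℂ).re := by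
  obtain ⟨h, h'⟩ := A.resolvent_spec f
  have := A.nonneg ⟨_, h⟩
  rwa [← eq_sub_iff_add_eq'.2 h']

theorem resolvent_nonneg : 0 ≤ A.resolvent := by
  rw [ContinuousLinearMap.nonneg_iff_isPositive, ContinuousLinearMap.isPositive_def]
  refine ⟨A.resolvent_isSelfAdjoint.isSymmetric, fun f => ?_⟩
  rw [ContinuousLinearMap.reApplyInnerSelf_apply, inner_apply_comm A.resolvent_isSelfAdjoint]
  have h := A.re_inner_sub_resolvent_nonneg f
  rw [inner_sub_left, Complex.sub_re, re_inner_self] at h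
  change 0 ≤ (⟪f, A.resolvent f⟫_ℂ).re
  nlinarith [sq_nonneg ‖A.resolvent f‖]

theorem norm_resolvent_apply_le (f : E) : ‖A.resolvent f‖ ≤ ‖f‖ := by
  obtain ⟨h, h'⟩ := A.resolvent_spec f
  have := A.norm_le_norm_add ⟨_, h⟩
  rwa [h'] at this

theorem resolvent_le_one : A.resolvent ≤ 1 := by
  rw [ContinuousLinearMap.le_def, ContinuousLinearMap.isPositive_def]
  refine ⟨((IsSelfAdjoint.one _).sub A.resolvent_isSelfAdjoint).isSymmetric, fun f => ?_⟩
  rw [ContinuousLinearMap.reApplyInnerSelf_apply, sub_apply,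
    inner_sub_left, map_sub]
  have h1 : RCLike.re ⟪A.resolvent f, f⟫_ℂ ≤ ‖A.resolvent f‖ * ‖f‖ := re_inner_le_norm _ _
  have h2 : RCLike.re ⟪(1 : E →L[ℂ] E) f, f⟫_ℂ = ‖f‖ ^ 2 := re_inner_self f
  rw [h2]
  nlinarith [A.norm_resolvent_apply_le f, norm_nonneg f]

theorem spectrum_resolvent_subset : spectrum ℝ A.resolvent ⊆ Set.Icc 0 1 := fun x hx => by
  refine ⟨spectrum_nonneg_of_nonneg A.resolvent_nonneg hx, ?_⟩
  have h := (le_algebraMap_iff_spectrum_le (r := (1 : ℝ)) (a := A.resolvent)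
    A.resolvent_isSelfAdjoint).1 (by rw [map_one]; exact A.resolvent_le_one)
  exact h x hx

/-- The operator `(1 / (1 + l) - (1 + A)⁻¹)₊`, whose kernel is the spectral subspace `[0, l]`. -/
noncomputable def cutoff (l : ℝ) : E →L[ℂ] E :=
  cfc (fun x : ℝ => max (1 / (1 + l) - x) 0) A.resolvent

theorem mem_spectralSubspace {l : ℝ} {f : E} : f ∈ A.spectralSubspace l ↔ A.cutoff l f = 0 :=
  Iff.rfl

theorem cutoff_isSelfAdjoint (l : ℝ) : IsSelfAdjoint (A.cutoff l) := cfc_predicate _ _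

theorem cutoff_resolvent_apply (l : ℝ) (f : E) :
    A.cutoff l (A.resolvent f) = A.resolvent (A.cutoff l f) := by
  have h : Commute (A.cutoff l) A.resolvent := by
    have := cfc_commute_cfc (R := ℝ) (fun x => max (1 / (1 + l) - x) 0) id A.resolvent
    rwa [cfc_id ℝ A.resolvent A.resolvent_isSelfAdjoint] at this
  exact congrArg (fun T : E →L[ℂ] E => T f) h.eq

theorem spectralSubspace_mono {l m : ℝ} (hl : 0 ≤ l) (h : l ≤ m) :
    A.spectralSubspace l ≤ A.spectralSubspace m := fun f hf => by
  rw [mem_spectralSubspace] at hf ⊢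
  have := norm_cfc_apply_le A.resolvent (φ := fun x : ℝ => max (1 / (1 + m) - x) 0)
    (ψ := fun x : ℝ => max (1 / (1 + l) - x) 0) (by fun_prop) (by fun_prop) (fun x _ => by
      rw [abs_of_nonneg (le_max_right _ _), abs_of_nonneg (le_max_right _ _)]
      gcongr) f
  change ‖A.cutoff m f‖ ≤ ‖A.cutoff l f‖ at this
  rw [hf, norm_zero] at this
  exact norm_le_zero_iff.1 this

theorem mem_kernel_iff {f : E} : f ∈ A.kernel ↔ A.resolvent f = f := by
  constructor
  · rintro ⟨g, hg, rfl⟩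
    have h := A.resolvent_add_apply g
    have hg' : A.op g = 0 := hg
    rwa [hg', add_zero] at h
  · intro hf
    obtain ⟨h, h'⟩ := A.resolvent_spec f
    refine ⟨⟨_, h⟩, ?_, hf⟩
    change A.op _ = 0
    have := h'.trans hf.symm
    rwa [add_eq_left] at this

/-- The spectrum of `R` lies in `[0, 1]`, where `(1 - x)₊ = 1 - x`; hence the cutoff at `0` is `1 -
R`, and its kernel consists of the fixed vectors of `R`. -/
theorem spectralSubspace_zero : A.spectralSubspace 0 = A.kernel := by
  ext f
  have h1 : cfc (fun x : ℝ => 1 - x) A.resolvent = 1 - A.resolvent := by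
    rw [cfc_sub (fun _ : ℝ => 1) (fun x => x) A.resolvent,
      cfc_const_one ℝ A.resolvent A.resolvent_isSelfAdjoint,
      cfc_id' ℝ A.resolvent A.resolvent_isSelfAdjoint]
  have h2 : A.cutoff 0 = 1 - A.resolvent := by
    rw [← h1]
    refine cfc_congr fun x hx => ?_
    have := (A.spectrum_resolvent_subset hx).2
    simp [this]
  rw [mem_spectralSubspace, mem_kernel_iff, h2, sub_apply, sub_eq_zero]
  exact eq_comm

/-- The bound `A ≥ l` on the orthogonal complement of the spectral subspace `[0, l]`. -/
theorem mul_norm_resolvent_sq_le {l : ℝ} (hl : 0 ≤ l) {k : E} (hk : k ∈ (A.spectralSubspace l)ᗮ) :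
    l * ‖A.resolvent k‖ ^ 2 ≤ (⟪k - A.resolvent k, A.resolvent k⟫_ℂ).re := by
  have hcl : IsClosed {k : E | l * ‖A.resolvent k‖ ^ 2
      ≤ (⟪k - A.resolvent k, A.resolvent k⟫_ℂ).re} :=
    isClosed_le (by fun_prop) (Complex.continuous_re.comp (by fun_prop))
  -- The complement of the kernel of a self-adjoint operator is the closure of its range, and the
  -- inequality is a closed condition, so it suffices to treat `k = φ(R) m`.
  have hk' : k ∈ closure (Set.range (A.cutoff l)) := by
    have h := (A.cutoff l).orthogonal_ker
    rw [ContinuousLinearMap.isSelfAdjoint_iff'.1 (A.cutoff_isSelfAdjoint l)] at h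
    have h2 : k ∈ (A.cutoff l).range.topologicalClosure := h ▸ hk
    exact h2
  refine hcl.closure_subset_iff.2 ?_ hk'
  rintro _ ⟨m, rfl⟩
  set R := A.resolvent
  have hR : IsSelfAdjoint R := A.resolvent_isSelfAdjoint
  set φ : ℝ → ℝ := fun x => max (1 / (1 + l) - x) 0
  have hφ : Continuous φ := by fun_prop
  -- The claim amounts to `⟨k, R k⟩ - (1 + l) ‖R k‖² ≥ 0`. For `k = φ(R) m` this is the form of the
  -- operator with symbol `φ² (x - (1 + l) x²)`, nonnegative because `φ` vanishes for `x ≥ 1 / (1 +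
  -- l)`.
  have hpos : 0 ≤ cfc (fun x : ℝ => φ x * ((x - (1 + l) * (x * x)) * φ x)) R := by
    refine cfc_nonneg fun x hx => ?_
    have hx0 := (A.spectrum_resolvent_subset hx).1
    rcases le_total (1 / (1 + l)) x with h | h
    · have : φ x = 0 := max_eq_right (by linarith)
      simp [this]
    · have h2 : (1 + l) * x ≤ 1 := by rwa [le_div_iff₀' (by linarith)] at h
      have h3 : 0 ≤ φ x := le_max_right _ _
      have h4 : 0 ≤ x - (1 + l) * (x * x) := by nlinarith
      positivity
  have e : cfc (fun x : ℝ => φ x * ((x - (1 + l) * (x * x)) * φ x)) R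
      = A.cutoff l * ((R - (1 + l) • (R * R)) * A.cutoff l) := by
    rw [cfc_mul φ (fun x => (x - (1 + l) * (x * x)) * φ x) R,
      cfc_mul (fun x => x - (1 + l) * (x * x)) φ R,
      cfc_sub (fun x : ℝ => x) (fun x => (1 + l) * (x * x)) R,
      cfc_const_mul (1 + l) (fun x : ℝ => x * x) R,
      cfc_mul (fun x : ℝ => x) (fun x => x) R, cfc_id' ℝ R hR]
    rfl
  rw [e, ContinuousLinearMap.nonneg_iff_isPositive] at hpos
  have h := hpos.re_inner_nonneg_left m
  set k := A.cutoff l m with hkm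
  have e2 : (A.cutoff l * ((R - (1 + l) • (R * R)) * A.cutoff l)) m
      = A.cutoff l (R k - (1 + l) • R (R k)) := rfl
  rw [e2, inner_apply_comm (A.cutoff_isSelfAdjoint l), ← hkm, inner_sub_left,
    ← Complex.coe_smul, inner_smul_left, Complex.conj_ofReal, inner_apply_comm hR (R k),
    inner_apply_comm hR k] at h
  have h' : 0 ≤ (⟪k, R k⟫_ℂ).re - (1 + l) * ‖R k‖ ^ 2 := by
    rw [← re_inner_self, ← Complex.re_ofReal_mul, ← Complex.sub_re]
    exact h
  change l * ‖R k‖ ^ 2 ≤ (⟪k - R k, R k⟫_ℂ).re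
  rw [inner_sub_left, Complex.sub_re, re_inner_self]
  linarith

/-- `R` commutes with the cutoff, so it preserves the kernel of the cutoff and, being self-adjoint,
the orthogonal complement too. -/
theorem projIcc_resolvent_apply (l : ℝ) (f : E) :
    A.projIcc l (A.resolvent f) = A.resolvent (A.projIcc l f) := by
  refine Submodule.eq_starProjection_of_mem_orthogonal (K := A.spectralSubspace l) ?_ ?_
  · have : A.projIcc l f ∈ A.spectralSubspace l := Submodule.starProjection_apply_mem _ _
    rw [mem_spectralSubspace] at this ⊢
    rw [cutoff_resolvent_apply, this, map_zero]
  · rw [← map_sub, Submodule.mem_orthogonal]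
    intro u hu
    rw [← inner_apply_comm A.resolvent_isSelfAdjoint]
    refine Submodule.sub_starProjection_mem_orthogonal (K := A.spectralSubspace l) f _ ?_
    rw [mem_spectralSubspace] at hu ⊢
    rw [cutoff_resolvent_apply, hu, map_zero]

/-- With `g = R h` the form is `⟨h - R h, R h⟩`. Splitting `h = p + k` along the spectral subspace,
which reduces `R`, kills the cross terms; the `p` part is nonnegative and the `k` part is at least
`l ‖R k‖²`. -/
theorem mul_norm_sub_projIcc_sq_le_inner {l : ℝ} (hl : 0 ≤ l) (g : A.op.domain) :
    l * ‖(g : E) - A.projIcc l g‖ ^ 2 ≤ (⟪A.op g, (g : E)⟫_ℂ).re := by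
  set h := (g : E) + A.op g with hh
  have hg : A.resolvent h = g := A.resolvent_add_apply g
  have hAg : A.op g = h - A.resolvent h := by rw [hg, hh]; abel
  rw [hAg, ← hg, projIcc_resolvent_apply, ← map_sub]
  set p := A.projIcc l h with hp
  set k := h - p with hk
  have hpm : p ∈ A.spectralSubspace l := Submodule.starProjection_apply_mem _ _
  have hkm : k ∈ (A.spectralSubspace l)ᗮ :=
    Submodule.sub_starProjection_mem_orthogonal (K := A.spectralSubspace l) h
  have hRp : A.resolvent p ∈ A.spectralSubspace l := by
    rw [hp, ← projIcc_resolvent_apply]; exact Submodule.starProjection_apply_mem _ _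
  have hRk : A.resolvent k ∈ (A.spectralSubspace l)ᗮ := by
    rw [hk, map_sub, hp, ← projIcc_resolvent_apply]
    exact Submodule.sub_starProjection_mem_orthogonal (K := A.spectralSubspace l) _
  have hsum : h = p + k := by rw [hk]; abel
  have c1 : ⟪p - A.resolvent p, A.resolvent k⟫_ℂ = 0 :=
    Submodule.inner_right_of_mem_orthogonal (Submodule.sub_mem _ hpm hRp) hRk
  have c2 : ⟪k - A.resolvent k, A.resolvent p⟫_ℂ = 0 :=
    Submodule.inner_left_of_mem_orthogonal hRp (Submodule.sub_mem _ hkm hRk)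
  have e : ⟪h - A.resolvent h, A.resolvent h⟫_ℂ = ⟪p - A.resolvent p, A.resolvent p⟫_ℂ
      + ⟪k - A.resolvent k, A.resolvent k⟫_ℂ := by
    have : h - A.resolvent h = (p - A.resolvent p) + (k - A.resolvent k) := by
      rw [hsum, map_add]; abel
    rw [this, inner_add_left, hsum, map_add, inner_add_right, inner_add_right, c1, c2]
    ring
  rw [e, Complex.add_re]
  have := A.re_inner_sub_resolvent_nonneg p
  have := A.mul_norm_resolvent_sq_le hl hkm
  linarith

/-- The scalar model is `(a / (1 + a))² ≤ a`. For `b = g - R g`, which satisfies `b + A b = A g`,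
positivity of the form at `g - b` gives `⟨A g, g⟩ ≥ 2 ‖b‖² + ⟨A b, b⟩`. The left side is bounded in
`g`, so the estimate extends to the closed form and identifies the vectors of zero energy. -/
theorem norm_sub_resolvent_sq_le_inner (g : A.op.domain) :
    ‖(g : E) - A.resolvent g‖ ^ 2 ≤ (⟪A.op g, (g : E)⟫_ℂ).re := by
  obtain ⟨hb, hb'⟩ := A.resolvent_spec (A.op g)
  set b : A.op.domain := ⟨A.resolvent (A.op g), hb⟩
  have e : (g : E) - A.resolvent g = b := by
    have := A.resolvent_add_apply g
    rw [map_add] at this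
    nth_rewrite 1 [← this]
    simp [b]
  change (b : E) + A.op b = A.op g at hb'
  rw [e]
  have h1 := A.nonneg (g - b)
  have h2 := A.nonneg b
  have h3 : (⟪A.op g, (b : E)⟫_ℂ).re = ‖(b : E)‖ ^ 2 + (⟪A.op b, (b : E)⟫_ℂ).re := by
    rw [← hb', inner_add_left, Complex.add_re, re_inner_self]
  have h4 : (⟪A.op b, (g : E)⟫_ℂ).re = (⟪A.op g, (b : E)⟫_ℂ).re := by
    rw [A.symm_apply, ← inner_conj_symm, Complex.conj_re]
  rw [LinearPMap.map_sub] at h1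
  push_cast at h1
  simp only [inner_sub_left, inner_sub_right, Complex.sub_re] at h1
  nlinarith [sq_nonneg ‖(b : E)‖]

/-- Lower bounds of the quadratic form by continuous functions pass to its closure. -/
theorem ofReal_le_energy {q : E → ℝ} (hq : Continuous q)
    (h : ∀ g : A.op.domain, q g ≤ (⟪A.op g, (g : E)⟫_ℂ).re) (f : E) :
    ENNReal.ofReal (q f) ≤ A.energy f := by
  -- Density of `D(A)` makes the filter nontrivial, so that the liminf of the continuous lower bound
  -- is its limit.
  have hne : (comap (fun g : A.op.domain => (g : E)) (𝓝 f)).NeBot := by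
    rw [comap_neBot_iff_frequently]
    have := (mem_closure_iff_frequently (s := (A.op.domain : Set E)) (x := f)).1
      (A.selfAdjoint.dense_domain f)
    exact this.mono fun x hx => ⟨⟨x, hx⟩, rfl⟩
  have ht : Tendsto (fun g : A.op.domain => ENNReal.ofReal (q g))
      (comap (fun g : A.op.domain => (g : E)) (𝓝 f)) (𝓝 (ENNReal.ofReal (q f))) :=
    ((ENNReal.continuous_ofReal.comp hq).tendsto f).comp tendsto_comap
  rw [← ht.liminf_eq]
  exact liminf_le_liminf (Eventually.of_forall fun g => ENNReal.ofReal_le_ofReal (h g))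

theorem ofReal_mul_enorm_sub_projIcc_sq_le {l : ℝ} (hl : 0 ≤ l) (f : E) :
    ENNReal.ofReal l * ‖f - A.projIcc l f‖ₑ ^ 2 ≤ A.energy f := by
  have := A.ofReal_le_energy (q := fun f => l * ‖f - A.projIcc l f‖ ^ 2) (by fun_prop)
    (A.mul_norm_sub_projIcc_sq_le_inner hl) f
  rwa [ENNReal.ofReal_mul hl, ENNReal.ofReal_pow (norm_nonneg _), ofReal_norm] at this

theorem mem_kernel_of_energy_eq_zero {f : E} (hf : A.energy f = 0) : f ∈ A.kernel := by
  have := A.ofReal_le_energy (q := fun f => ‖f - A.resolvent f‖ ^ 2) (by fun_prop)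
    A.norm_sub_resolvent_sq_le_inner f
  rw [hf, nonpos_iff_eq_zero, ENNReal.ofReal_eq_zero] at this
  have h2 : ‖f - A.resolvent f‖ = 0 := by
    have := le_antisymm this (sq_nonneg _)
    simpa using this
  rw [mem_kernel_iff]
  exact (sub_eq_zero.1 (norm_eq_zero.1 h2)).symm

theorem isStarProjection_projIcc (l : ℝ) : IsStarProjection (A.projIcc l) :=
  isStarProjection_starProjection

theorem isStarProjection_projIoc {l : ℝ} (hl : 0 ≤ l) : IsStarProjection (A.projIoc l) := by
  refine (A.isStarProjection_projIcc 0).sub_of_mul_eq_right (A.isStarProjection_projIcc l) ?_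
  ext f
  exact Submodule.starProjection_eq_self_iff.2
    (A.spectralSubspace_mono le_rfl hl (Submodule.starProjection_apply_mem _ f))

theorem projIcc_apply_of_mem_kernel {f : E} (hf : f ∈ A.kernel) : A.projIcc 0 f = f :=
  Submodule.starProjection_eq_self_iff.2 (A.spectralSubspace_zero ▸ hf)

theorem projIoc_apply_of_mem_kernel_orthogonal (l : ℝ) {f : E} (hf : f ∈ A.kernelᗮ) :
    A.projIoc l f = A.projIcc l f := by
  have : A.projIcc 0 f = 0 :=
    (Submodule.starProjection_apply_eq_zero_iff (A.spectralSubspace 0)).2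
      (A.spectralSubspace_zero ▸ hf)
  rw [projIoc, sub_apply, this, sub_zero]

end PosSelfAdjoint

/-- If `d` is at most a quarter of `t`, then `a` is at least three quarters. This yields `3 t ≤ 4
a`, which is weakened to the constant `4`; finiteness of `t` allows the cancellation. -/
theorem le_four_mul_of_four_mul_le {t a d : ℝ≥0∞} (h : t = a + d) (hd : 4 * d ≤ t) (ht : t ≠ ∞) :
    t ≤ 4 * a := by
  have h1 : 3 * t + t ≤ 4 * a + t := by
    calc 3 * t + t = 4 * t := by ring
      _ = 4 * a + 4 * d := by rw [← mul_add, ← h]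
      _ ≤ 4 * a + t := by gcongr
  have h2 : 3 * t ≤ 4 * a := ENNReal.le_of_add_le_add_right ht h1
  exact (le_mul_of_one_le_left (zero_le) (by norm_num)).trans h2

/-! ### Traces, square roots and Hilbert–Schmidt sums -/

section Hilbert

variable {E : Type*} [NormedAddCommGroup E] [InnerProductSpace ℂ E] [CompleteSpace E]

theorem enorm_sq_eq_add {P : E →L[ℂ] E} (hP : IsStarProjection P) (f : E) :
    ‖f‖ₑ ^ 2 = ‖P f‖ₑ ^ 2 + ‖f - P f‖ₑ ^ 2 := by
  have hPP : P (P f) = P f := congrArg (fun T : E →L[ℂ] E => T f) hP.isIdempotentElem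
  have h0 : ⟪P f, f - P f⟫_ℂ = 0 := by
    rw [inner_apply_comm hP.isSelfAdjoint, map_sub, hPP, sub_self, inner_zero_right]
  have h := norm_add_sq_eq_norm_sq_add_norm_sq_of_inner_eq_zero _ _ h0
  rw [add_sub_cancel] at h
  simp only [← pow_two] at h
  simp only [← ofReal_norm]
  rw [← ENNReal.ofReal_pow (norm_nonneg _), ← ENNReal.ofReal_pow (norm_nonneg _),
    ← ENNReal.ofReal_pow (norm_nonneg _), ← ENNReal.ofReal_add (sq_nonneg _) (sq_nonneg _), h]

theorem trace_comp_comp {P C : E →L[ℂ] E} (hP : IsStarProjection P) (hC : IsSelfAdjoint C)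
    {ι : Type*} (b : HilbertBasis ι ℂ E) :
    trace (C ∘L P ∘L C) = ∑' i, ‖P (C (b i))‖ₑ ^ 2 := by
  have hpos : (C ∘L P ∘L C).IsPositive := by
    have h := (ContinuousLinearMap.IsPositive.of_isStarProjection hP).conj_adjoint C
    rwa [ContinuousLinearMap.isSelfAdjoint_iff'.1 hC] at h
  rw [trace_eq_tsum b hpos]
  refine tsum_congr fun i => ?_
  have hPP : P (P (C (b i))) = P (C (b i)) :=
    congrArg (fun T : E →L[ℂ] E => T (C (b i))) hP.isIdempotentElem
  change ENNReal.ofReal (⟪C (P (C (b i))), b i⟫_ℂ).re = _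
  rw [inner_apply_comm hC, ← hPP, inner_apply_comm hP.isSelfAdjoint, ofReal_re_inner_self, hPP]

theorem sqrt_isSelfAdjoint (ρ : E →L[ℂ] E) : IsSelfAdjoint (CFC.sqrt ρ) :=
  (CFC.sqrt_nonneg ρ).isSelfAdjoint

theorem sqrt_sqrt_apply {ρ : E →L[ℂ] E} (hρ : ρ.IsPositive) (f : E) :
    CFC.sqrt ρ (CFC.sqrt ρ f) = ρ f :=
  congrArg (fun T : E →L[ℂ] E => T f)
    (CFC.sqrt_mul_sqrt_self ρ ((ContinuousLinearMap.nonneg_iff_isPositive ρ).2 hρ))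

theorem ofReal_re_inner_eq_enorm_sqrt_sq {ρ : E →L[ℂ] E} (hρ : ρ.IsPositive) (f : E) :
    ENNReal.ofReal (⟪ρ f, f⟫_ℂ).re = ‖CFC.sqrt ρ f‖ₑ ^ 2 := by
  rw [← sqrt_sqrt_apply hρ, inner_apply_comm (sqrt_isSelfAdjoint ρ), ofReal_re_inner_self]

theorem sqrt_apply_eq_zero {ρ : E →L[ℂ] E} (hρ : ρ.IsPositive) {f : E} (hf : ρ f = 0) :
    CFC.sqrt ρ f = 0 := by
  have h := ofReal_re_inner_eq_enorm_sqrt_sq hρ f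
  rw [hf, inner_zero_left, Complex.zero_re, ENNReal.ofReal_zero] at h
  simpa using h.symm

/-- `ρ^{1/2}` is self-adjoint with the same kernel as `ρ`. This puts the vectors `ρ^{1/2} e_i` into
`W`. -/
theorem sqrt_apply_mem_orthogonal {ρ : E →L[ℂ] E} (hρ : ρ.IsPositive) {K : Submodule ℂ E}
    (hK : ∀ u ∈ K, ρ u = 0) (f : E) : CFC.sqrt ρ f ∈ Kᗮ := by
  rw [Submodule.mem_orthogonal]
  intro u hu
  rw [← inner_apply_comm (sqrt_isSelfAdjoint ρ), sqrt_apply_eq_zero hρ (hK u hu), inner_zero_left]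

theorem trace_eq_tsum_sqrt {ρ : E →L[ℂ] E} (hρ : ρ.IsPositive) {ι : Type*}
    (b : HilbertBasis ι ℂ E) : trace ρ = ∑' i, ‖CFC.sqrt ρ (b i)‖ₑ ^ 2 := by
  rw [trace_eq_tsum b hρ]
  exact tsum_congr fun i => ofReal_re_inner_eq_enorm_sqrt_sq hρ _

theorem trace_ne_zero {ρ : E →L[ℂ] E} (hρ : ρ.IsPositive) (h0 : ρ ≠ 0) : trace ρ ≠ 0 := by
  intro h
  obtain ⟨_, b, -⟩ := exists_hilbertBasis ℂ E
  rw [trace_eq_tsum_sqrt hρ b, ENNReal.tsum_eq_zero] at h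
  refine h0 (ContinuousLinearMap.ext fun f => ?_)
  have h2 : ‖CFC.sqrt ρ f‖ₑ ^ 2 = 0 := by
    rw [← tsum_enorm_inner_sq b, ENNReal.tsum_eq_zero]
    intro i
    have := h i
    rw [← inner_apply_comm (sqrt_isSelfAdjoint ρ)]
    have hi : CFC.sqrt ρ (b i) = 0 := by simpa using this
    simp [hi]
  have h3 : CFC.sqrt ρ f = 0 := by simpa using h2
  rw [← sqrt_sqrt_apply hρ, h3, map_zero]
  rfl

theorem enorm_sqrt_sq {ρ : E →L[ℂ] E} (hρ : ρ.IsPositive) : ‖CFC.sqrt ρ‖ₑ ^ 2 = ‖ρ‖ₑ := by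
  have h : ‖CFC.sqrt ρ * CFC.sqrt ρ‖ = ‖CFC.sqrt ρ‖ ^ 2 :=
    (sqrt_isSelfAdjoint ρ).norm_mul_self
  rw [CFC.sqrt_mul_sqrt_self ρ ((ContinuousLinearMap.nonneg_iff_isPositive ρ).2 hρ)] at h
  rw [← ofReal_norm, ← ofReal_norm, h, ENNReal.ofReal_pow (norm_nonneg _)]

/-- The Hilbert–Schmidt bound `τ(P ρ P) ≤ ‖ρ‖ τ(C P C)` for `ρ = C ρ C`. -/
theorem tsum_enorm_proj_sqrt_sq_le {P C ρ : E →L[ℂ] E} (hP : IsStarProjection P)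
    (hC : IsSelfAdjoint C) (hρ : ρ.IsPositive) (hCρ : ∀ f, C (ρ f) = ρ f) {ι : Type*}
    (b : HilbertBasis ι ℂ E) :
    ∑' i, ‖P (CFC.sqrt ρ (b i))‖ₑ ^ 2 ≤ ‖ρ‖ₑ * trace (C ∘L P ∘L C) := by
  set S := CFC.sqrt ρ
  have hS : IsSelfAdjoint S := sqrt_isSelfAdjoint ρ
  have hρC (f : E) : ρ (C f) = ρ f := by
    refine ext_inner_right ℂ fun g => ?_
    rw [inner_apply_comm hρ.isSelfAdjoint, inner_apply_comm hC, hCρ,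
      inner_apply_comm hρ.isSelfAdjoint]
  have hSC (f : E) : S (C f) = S f := by
    rw [← sub_eq_zero, ← map_sub]
    exact sqrt_apply_eq_zero hρ (by rw [map_sub, hρC, sub_self])
  -- In Hilbert–Schmidt norm, `‖P S‖ = ‖S P‖ = ‖S C P‖ ≤ ‖S‖ ‖C P‖ = ‖S‖ ‖P C‖`, and `‖S‖² = ‖ρ‖`.
  have h1 := tsum_enorm_sq_eq_adjoint b b (P ∘L S)
  rw [ContinuousLinearMap.adjoint_comp, ContinuousLinearMap.isSelfAdjoint_iff'.1 hS,
    ContinuousLinearMap.isSelfAdjoint_iff'.1 hP.isSelfAdjoint] at h1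
  have h2 := tsum_enorm_sq_eq_adjoint b b (P ∘L C)
  rw [ContinuousLinearMap.adjoint_comp, ContinuousLinearMap.isSelfAdjoint_iff'.1 hC,
    ContinuousLinearMap.isSelfAdjoint_iff'.1 hP.isSelfAdjoint] at h2
  simp only [ContinuousLinearMap.comp_apply] at h1 h2
  rw [h1, trace_comp_comp hP hC b, h2, ← ENNReal.tsum_mul_left]
  refine ENNReal.tsum_le_tsum fun i => ?_
  rw [← hSC, ← enorm_sqrt_sq hρ, ← mul_pow]
  gcongr
  exact S.le_opENorm _

end Hilbert

/-! ### The Chebyshev argument for both settings -/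

namespace PosSelfAdjoint

variable {E : Type*} [NormedAddCommGroup E] [InnerProductSpace ℂ E] [CompleteSpace E]
  {A : PosSelfAdjoint E}

/-- A family of projections `P l` such that on `Kᗮ` the form of `A` is at least `l` on the range
of `1 - P l`. -/
structure IsCutoff (A : PosSelfAdjoint E) (K : Submodule ℂ E) (P : ℝ → E →L[ℂ] E) : Prop where
  isStarProjection : ∀ l, 0 ≤ l → IsStarProjection (P l)
  mul_le_energy : ∀ l, 0 ≤ l → ∀ f ∈ Kᗮ, ENNReal.ofReal l * ‖f - P l f‖ₑ ^ 2 ≤ A.energy f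
  -- This replaces the preceding bound at `l = 0`, where that bound is empty.
  apply_eq_self : ∀ f ∈ Kᗮ, A.energy f = 0 → P 0 f = f

theorem isCutoff_projIcc (A : PosSelfAdjoint E) : A.IsCutoff ⊥ A.projIcc where
  isStarProjection l _ := A.isStarProjection_projIcc l
  mul_le_energy _ hl f _ := A.ofReal_mul_enorm_sub_projIcc_sq_le hl f
  apply_eq_self _ _ h := A.projIcc_apply_of_mem_kernel (A.mem_kernel_of_energy_eq_zero h)

theorem isCutoff_projIoc (A : PosSelfAdjoint E) : A.IsCutoff A.kernel A.projIoc where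
  isStarProjection _ hl := A.isStarProjection_projIoc hl
  mul_le_energy l hl f hf := by
    rw [A.projIoc_apply_of_mem_kernel_orthogonal l hf]
    exact A.ofReal_mul_enorm_sub_projIcc_sq_le hl f
  apply_eq_self f hf h := by
    rw [A.projIoc_apply_of_mem_kernel_orthogonal 0 hf]
    exact A.projIcc_apply_of_mem_kernel (A.mem_kernel_of_energy_eq_zero h)

namespace IsCutoff

variable {K : Submodule ℂ E} {P : ℝ → E →L[ℂ] E} {C ρ : E →L[ℂ] E}

/-- At any fixed `l > 0` the trace splits into a low-energy part, at most `‖ρ‖ τ(C P_l C)`, and a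
high-energy part, at most `𝓔(ρ) / l`. -/
theorem trace_ne_top (hP : A.IsCutoff K P) (hC : IsSelfAdjoint C) (hρ : ρ.IsPositive)
    (hCρ : ∀ f, C (ρ f) = ρ f) (hK : ∀ u ∈ K, ρ u = 0) (hE : A.stateEnergy ρ ≠ ∞)
    {l : ℝ} (hl : 0 < l) (ht : trace (C ∘L P l ∘L C) ≠ ∞) : trace ρ ≠ ∞ := by
  obtain ⟨b, hb⟩ := (exists_hilbertBasis ℂ E).choose_spec
  have hPl := hP.isStarProjection l hl.le
  rw [trace_eq_tsum_sqrt hρ b]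
  simp only [enorm_sq_eq_add hPl (CFC.sqrt ρ _)]
  rw [ENNReal.tsum_add]
  refine ENNReal.add_ne_top.2 ⟨ne_top_of_le_ne_top (ENNReal.mul_ne_top enorm_ne_top ht)
    (tsum_enorm_proj_sqrt_sq_le hPl hC hρ hCρ b), fun h => hE ?_⟩
  rw [← top_le_iff, ← ENNReal.mul_top (ENNReal.ofReal_pos.2 hl).ne', ← h, ← ENNReal.tsum_mul_left,
    stateEnergy, basisSum]
  refine ENNReal.tsum_le_tsum fun i => ?_
  rw [hb]
  exact hP.mul_le_energy l hl.le _ (sqrt_apply_mem_orthogonal hρ hK _)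

theorem trace_div_le (hP : A.IsCutoff K P) (hC : IsSelfAdjoint C) (hρ : ρ.IsPositive) (h0 : ρ ≠ 0)
    (hCρ : ∀ f, C (ρ f) = ρ f) (hK : ∀ u ∈ K, ρ u = 0) (hE : A.stateEnergy ρ ≠ ∞)
    (ht : trace ρ ≠ ∞) :
    trace ρ / (4 * ‖ρ‖ₑ) ≤ trace (C ∘L P (4 * A.expectation ρ) ∘L C) := by
  -- The basis has to be the one chosen in `basisSum`, because `stateEnergy` is a sum over that
  -- basis.
  obtain ⟨b, hb⟩ := (exists_hilbertBasis ℂ E).choose_spec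
  have hτ := trace_ne_zero hρ h0
  have hl : 0 ≤ 4 * A.expectation ρ := mul_nonneg (by norm_num) ENNReal.toReal_nonneg
  set l := 4 * A.expectation ρ with hl'
  have hPl := hP.isStarProjection l hl
  have hlE : ENNReal.ofReal l = 4 * (A.stateEnergy ρ / trace ρ) := by
    rw [hl', ENNReal.ofReal_mul (by norm_num), expectation,
      ENNReal.ofReal_toReal (ENNReal.div_ne_top hE hτ)]
    norm_num
  have hsum : trace ρ = ∑' i, ‖P l (CFC.sqrt ρ (b i))‖ₑ ^ 2
      + ∑' i, ‖CFC.sqrt ρ (b i) - P l (CFC.sqrt ρ (b i))‖ₑ ^ 2 := by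
    rw [trace_eq_tsum_sqrt hρ b, ← ENNReal.tsum_add]
    exact tsum_congr fun i => enorm_sq_eq_add hPl _
  have hEb : A.stateEnergy ρ = ∑' i, A.energy (CFC.sqrt ρ (b i)) := by
    rw [stateEnergy, basisSum, hb]
  have hd : 4 * ∑' i, ‖CFC.sqrt ρ (b i) - P l (CFC.sqrt ρ (b i))‖ₑ ^ 2 ≤ trace ρ := by
    -- If `𝓔(ρ) = 0`, then `l = 0` and every `ρ^{1/2} e_i` is fixed by `P 0`. Otherwise Chebyshev
    -- with `l = 4 𝓔(ρ) / τ(ρ)` applies, and the factor `𝓔(ρ)` cancels.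
    rcases eq_or_ne (A.stateEnergy ρ) 0 with h | h
    · have hl0 : l = 0 := by rw [hl', expectation, h]; simp
      rw [hEb, ENNReal.tsum_eq_zero] at h
      have hz (i) : ‖CFC.sqrt ρ (b i) - P l (CFC.sqrt ρ (b i))‖ₑ ^ 2 = 0 := by
        rw [hl0, hP.apply_eq_self _ (sqrt_apply_mem_orthogonal hρ hK _) (h i)]
        simp
      simp [hz]
    · have h1 : ENNReal.ofReal l * ∑' i, ‖CFC.sqrt ρ (b i) - P l (CFC.sqrt ρ (b i))‖ₑ ^ 2
          ≤ A.stateEnergy ρ := by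
        rw [← ENNReal.tsum_mul_left, hEb]
        exact ENNReal.tsum_le_tsum fun i => hP.mul_le_energy l hl _ (sqrt_apply_mem_orthogonal hρ hK _)
      set d := ∑' i, ‖CFC.sqrt ρ (b i) - P l (CFC.sqrt ρ (b i))‖ₑ ^ 2
      rw [hlE] at h1
      have h2 : A.stateEnergy ρ * (4 * d) ≤ A.stateEnergy ρ * trace ρ := by
        calc A.stateEnergy ρ * (4 * d)
            = 4 * (A.stateEnergy ρ / trace ρ * trace ρ) * d := by
              rw [ENNReal.div_mul_cancel hτ ht]; ring
          _ = 4 * (A.stateEnergy ρ / trace ρ) * d * trace ρ := by ring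
          _ ≤ A.stateEnergy ρ * trace ρ := by gcongr
      exact (ENNReal.mul_le_mul_iff_right h hE).1 h2
  refine ENNReal.div_le_of_le_mul ((le_four_mul_of_four_mul_le hsum hd ht).trans ?_)
  calc 4 * ∑' i, ‖P l (CFC.sqrt ρ (b i))‖ₑ ^ 2
      ≤ 4 * (‖ρ‖ₑ * trace (C ∘L P l ∘L C)) := by
        gcongr
        exact tsum_enorm_proj_sqrt_sq_le hPl hC hρ hCρ b
    _ = _ := by ring

theorem enorm_sq_le (hP : A.IsCutoff K P) {l : ℝ} (hl : 0 ≤ l) {f : E} (hf : f ∈ Kᗮ)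
    (hE : A.energy f ≤ ENNReal.ofReal (l * ‖f‖ ^ 2)) :
    ‖f‖ₑ ^ 2 ≤ 4 * ‖P (4 * l) f‖ₑ ^ 2 := by
  have hl4 : 0 ≤ 4 * l := by positivity
  refine le_four_mul_of_four_mul_le (enorm_sq_eq_add (hP.isStarProjection _ hl4) f) ?_
    (ENNReal.pow_ne_top enorm_ne_top)
  rcases hl.eq_or_lt with rfl | h
  · rw [zero_mul, ENNReal.ofReal_zero, nonpos_iff_eq_zero] at hE
    rw [mul_zero, hP.apply_eq_self f hf hE]
    simp
  · have h1 := (hP.mul_le_energy _ hl4 f hf).trans hE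
    rw [mul_comm 4 l, ENNReal.ofReal_mul hl, ENNReal.ofReal_mul hl,
      ENNReal.ofReal_pow (norm_nonneg _), ofReal_norm, mul_assoc] at h1
    have h2 := (ENNReal.mul_le_mul_iff_right (ENNReal.ofReal_pos.2 h).ne'
      ENNReal.ofReal_ne_top).1 h1
    rw [mul_comm l 4] at h2
    simpa using h2

/-- For orthonormal `v_1, …, v_n` in `V`, `n = ∑ ‖v_i‖² ≤ 4 ∑ ‖P C v_i‖²`, and the last sum is part
of the trace in a Hilbert basis extending the family. -/
theorem toENat_rank_le (hP : A.IsCutoff K P) (hC : IsSelfAdjoint C) {l : ℝ} (hl : 0 ≤ l)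
    {V : Submodule ℂ E} (hVK : V ≤ Kᗮ) (hCV : ∀ f ∈ V, C f = f)
    (hE : ∀ f ∈ V, A.energy f ≤ ENNReal.ofReal (l * ‖f‖ ^ 2)) :
    ((Cardinal.toENat (Module.rank ℂ V) : ℕ∞) : ℝ≥0∞) ≤ 4 * trace (C ∘L P (4 * l) ∘L C) := by
  -- Bounding every natural number below the rank covers infinite-dimensional `V` as well: the right
  -- side is then forced to be `∞`.
  have key (n : ℕ) (hn : (n : ℕ∞) ≤ Cardinal.toENat (Module.rank ℂ V)) :
      (n : ℝ≥0∞) ≤ 4 * trace (C ∘L P (4 * l) ∘L C) := by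
    rw [Cardinal.natCast_le_toENat, Module.le_rank_iff] at hn
    obtain ⟨u, hu⟩ := hn
    set v : Fin n → V := InnerProductSpace.gramSchmidtNormed ℂ u
    have hv : Orthonormal ℂ v := InnerProductSpace.gramSchmidtNormed_orthonormal hu
    have hv' : Orthonormal ℂ fun i => (v i : E) := hv.comp_linearIsometry V.subtypeₗᵢ
    obtain ⟨w, b, hw, hb⟩ := hv'.toSubtypeRange.exists_hilbertBasis_extension
    have hinj : Function.Injective fun i => (⟨v i, hw ⟨i, rfl⟩⟩ : w) := fun i j hij =>
      hv'.linearIndependent.injective (congrArg (fun x : w => (x : E)) hij)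
    rw [trace_comp_comp (hP.isStarProjection _ (by positivity)) hC b]
    calc (n : ℝ≥0∞) = ∑ i, ‖(v i : E)‖ₑ ^ 2 := by
          have (i : Fin n) : ‖(v i : E)‖ₑ = 1 := by rw [← ofReal_norm, hv'.1 i]; simp
          simp [this]
      _ ≤ ∑ i, 4 * ‖P (4 * l) (C (v i))‖ₑ ^ 2 := Finset.sum_le_sum fun i _ => by
          rw [hCV _ (v i).2]
          exact hP.enorm_sq_le hl (hVK (v i).2) (hE _ (v i).2)
      _ = 4 * ∑' i, ‖P (4 * l) (C (v i))‖ₑ ^ 2 := by rw [← Finset.mul_sum, tsum_fintype]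
      _ ≤ _ := by
          gcongr
          simp only [hb]
          exact ENNReal.tsum_comp_le_tsum_of_injective hinj
            fun x : w => ‖P (4 * l) (C (x : E))‖ₑ ^ 2
  cases h : Cardinal.toENat (Module.rank ℂ V) with
  | top =>
    by_contra hlt
    obtain ⟨n, hn⟩ := ENNReal.exists_nat_gt (not_le.1 hlt).ne_top
    exact (key n (h ▸ le_top)).not_gt hn
  | coe n => exact key n h.ge

end IsCutoff

end PosSelfAdjoint

/-! ### Localization to `Ω` and densities -/

section Lp

variable {X : Type*} [MeasurableSpace X] {μ : Measure X}
  {H : Type*} [NormedAddCommGroup H] [InnerProductSpace ℂ H]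

theorem coeFn_chi {Ω : Set X} (hΩ : MeasurableSet Ω) (f : Lp H 2 μ) :
    chi hΩ f =ᵐ[μ] Ω.indicator f := by
  have h : chi hΩ f = chiLin hΩ f := by rw [chi, LinearMap.mkContinuous_apply]
  have h' : chiLin hΩ f = MemLp.toLp (Ω.indicator f) ((Lp.memLp f).indicator hΩ) := rfl
  rw [h, h']
  exact MemLp.coeFn_toLp _

theorem chi_apply_of_supportedIn {Ω : Set X} (hΩ : MeasurableSet Ω) {f : Lp H 2 μ}
    (hf : SupportedIn Ω f) : chi hΩ f = f := by
  refine Lp.ext ?_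
  filter_upwards [coeFn_chi hΩ f, hf] with x h1 h2
  rw [h1]
  by_cases h : x ∈ Ω
  · rw [Set.indicator_of_mem h]
  · rw [Set.indicator_of_notMem h, h2 h]

theorem chi_eq_zero {Ω : Set X} (hΩ : MeasurableSet Ω) (h0 : μ Ω = 0) :
    (chi hΩ : Lp H 2 μ →L[ℂ] Lp H 2 μ) = 0 := by
  ext1 f
  refine Lp.ext ?_
  filter_upwards [coeFn_chi hΩ f, Lp.coeFn_zero H 2 μ, measure_eq_zero_iff_ae_notMem.1 h0]
    with x h1 h2 h3
  rw [h1, Set.indicator_of_notMem h3]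
  exact h2.symm

variable [CompleteSpace H]

theorem chi_isSelfAdjoint {Ω : Set X} (hΩ : MeasurableSet Ω) :
    IsSelfAdjoint (chi hΩ : Lp H 2 μ →L[ℂ] Lp H 2 μ) := by
  rw [ContinuousLinearMap.isSelfAdjoint_iff_isSymmetric]
  intro f g
  change ⟪chi hΩ f, g⟫_ℂ = ⟪f, chi hΩ g⟫_ℂ
  rw [L2.inner_def, L2.inner_def]
  refine integral_congr_ae ?_
  filter_upwards [coeFn_chi hΩ f, coeFn_chi hΩ g] with x h1 h2
  rw [h1, h2]
  by_cases h : x ∈ Ω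
  · rw [Set.indicator_of_mem h, Set.indicator_of_mem h]
  · rw [Set.indicator_of_notMem h, Set.indicator_of_notMem h, inner_zero_left, inner_zero_right]

theorem nu_le_mul_density (P : Lp H 2 μ →L[ℂ] Lp H 2 μ) {Ω : Set X} (hΩ : MeasurableSet Ω)
    (hμΩ : μ Ω ≠ ∞) : nu P hΩ ≤ μ Ω * density P := by
  -- A null set contributes nothing to the supremum defining the density, but there `χ_Ω = 0`, so
  -- `ν_P(Ω) = 0`.
  rcases eq_or_ne (μ Ω) 0 with h | h
  · have : nu P hΩ = 0 := by
      rw [nu, chi_eq_zero hΩ h, ContinuousLinearMap.zero_comp]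
      simp [trace, basisSum]
    rw [this]
    exact zero_le
  · rw [mul_comm, ← ENNReal.div_le_iff_le_mul (Or.inl h) (Or.inl hμΩ)]
    exact le_iSup₂_of_le Ω hΩ le_rfl

variable {A : PosSelfAdjoint (Lp H 2 μ)} {K : Submodule ℂ (Lp H 2 μ)}
  {P : ℝ → Lp H 2 μ →L[ℂ] Lp H 2 μ} {Ω : Set X}

theorem PosSelfAdjoint.IsCutoff.trace_bounds (hP : A.IsCutoff K P) (hΩ : MeasurableSet Ω)
    (hμΩ : μ Ω ≠ ∞) {ρ : Lp H 2 μ →L[ℂ] Lp H 2 μ} (hρ : ρ.IsPositive) (h0 : ρ ≠ 0)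
    (hs : ∀ f, SupportedIn Ω (ρ f)) (hK : ∀ u ∈ K, ρ u = 0) (hE : A.stateEnergy ρ ≠ ∞)
    (h : trace ρ ≠ ∞ ∨ ∃ l : ℝ, 0 < l ∧ nu (P l) hΩ ≠ ∞) :
    trace ρ ≠ ∞ ∧ trace ρ / (4 * ‖ρ‖ₑ) ≤ nu (P (4 * A.expectation ρ)) hΩ ∧
      nu (P (4 * A.expectation ρ)) hΩ ≤ μ Ω * density (P (4 * A.expectation ρ)) := by
  have hχ (f : Lp H 2 μ) : chi hΩ (ρ f) = ρ f := chi_apply_of_supportedIn hΩ (hs f)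
  have ht : trace ρ ≠ ∞ := by
    rcases h with h | ⟨l, hl, hν⟩
    · exact h
    · exact hP.trace_ne_top (chi_isSelfAdjoint hΩ) hρ hχ hK hE hl hν
  exact ⟨ht, hP.trace_div_le (chi_isSelfAdjoint hΩ) hρ h0 hχ hK hE ht, nu_le_mul_density _ hΩ hμΩ⟩

theorem PosSelfAdjoint.IsCutoff.dirichletCount_le (hP : A.IsCutoff K P) (hΩ : MeasurableSet Ω)
    (hμΩ : μ Ω ≠ ∞) {l : ℝ} (hl : 0 ≤ l) :
    dirichletCount A Kᗮ Ω l ≤ 4 * μ Ω * density (P (4 * l)) := by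
  refine iSup_le fun V => iSup_le fun hVK => iSup_le fun hs => iSup_le fun hE => ?_
  refine (hP.toENat_rank_le (chi_isSelfAdjoint hΩ) hl hVK
    (fun f hf => chi_apply_of_supportedIn hΩ (hs f hf)) hE).trans ?_
  rw [mul_assoc]
  gcongr
  exact nu_le_mul_density _ hΩ hμΩ

end Lp

end SpectralFK

/-! ### The two settings -/

theorem mainTheorem4 {X : Type*} [MeasurableSpace X] (μ : Measure X)
    {H : Type*} [NormedAddCommGroup H] [InnerProductSpace ℂ H] [CompleteSpace H]
    (A : SpectralFK.PosSelfAdjoint (Lp H 2 μ))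
    (Ω : Set X) (hΩ : MeasurableSet Ω) (hμΩ : μ Ω ≠ ∞) :
    -- spectral projections of `[0, l]`, arbitrary states
    ((∀ ρ : Lp H 2 μ →L[ℂ] Lp H 2 μ, ρ.IsPositive → ρ ≠ 0 →
        (∀ f, SpectralFK.SupportedIn Ω (ρ f)) →
        A.stateEnergy ρ ≠ ∞ →
        (SpectralFK.trace ρ ≠ ∞ ∨ ∃ l : ℝ, 0 < l ∧ SpectralFK.nu (A.projIcc l) hΩ ≠ ∞) →
        SpectralFK.trace ρ ≠ ∞ ∧
        SpectralFK.trace ρ / (4 * ‖ρ‖ₑ)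
          ≤ SpectralFK.nu (A.projIcc (4 * A.expectation ρ)) hΩ ∧
        SpectralFK.nu (A.projIcc (4 * A.expectation ρ)) hΩ
          ≤ μ Ω * SpectralFK.density (A.projIcc (4 * A.expectation ρ))) ∧
      ∀ l : ℝ, 0 ≤ l →
        SpectralFK.dirichletCount A ⊤ Ω l
          ≤ 4 * μ Ω * SpectralFK.density (A.projIcc (4 * l))) ∧
    -- spectral projections of `]0, l]`, states that vanish on the kernel of `A`
    ((∀ ρ : Lp H 2 μ →L[ℂ] Lp H 2 μ, ρ.IsPositive → ρ ≠ 0 →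
        (∀ f ∈ A.kernel, ρ f = 0) →
        (∀ f, SpectralFK.SupportedIn Ω (ρ f)) →
        A.stateEnergy ρ ≠ ∞ →
        (SpectralFK.trace ρ ≠ ∞ ∨ ∃ l : ℝ, 0 < l ∧ SpectralFK.nu (A.projIoc l) hΩ ≠ ∞) →
        SpectralFK.trace ρ ≠ ∞ ∧
        SpectralFK.trace ρ / (4 * ‖ρ‖ₑ)
          ≤ SpectralFK.nu (A.projIoc (4 * A.expectation ρ)) hΩ ∧
        SpectralFK.nu (A.projIoc (4 * A.expectation ρ)) hΩ
          ≤ μ Ω * SpectralFK.density (A.projIoc (4 * A.expectation ρ))) ∧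
      ∀ l : ℝ, 0 ≤ l →
        SpectralFK.dirichletCount A A.kernelᗮ Ω l
          ≤ 4 * μ Ω * SpectralFK.density (A.projIoc (4 * l))) := by
  refine ⟨⟨fun ρ hρ h0 hs hE h => A.isCutoff_projIcc.trace_bounds hΩ hμΩ hρ h0 hs (fun u hu => ?_)
      hE h, fun l hl => ?_⟩,
    fun ρ hρ h0 hk hs hE h => A.isCutoff_projIoc.trace_bounds hΩ hμΩ hρ h0 hs hk hE h,
    fun l hl => A.isCutoff_projIoc.dirichletCount_le hΩ hμΩ hl⟩
  · rw [(Submodule.mem_bot ℂ).1 hu, map_zero]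
  · rw [← Submodule.bot_orthogonal_eq_top]
    exact A.isCutoff_projIcc.dirichletCount_le hΩ hμΩ hl
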